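/- For every $\epsilon>0$ there is a constant $C=C(\epsilon)>0$, depending only on $\epsilon$, such that for every prime $p$, all integers $a,b$ with $\gcd(a,b,p)=1$, and every primitive root $\lambda$ modulo $p$, $$H_{a,b}=\sum_{y=1}^{p-1}\Bigg|\sum_{\substack{1\le x\le p-1\\ \gcd(x,p-1)=1}} e_p\big(a\lambda^x+b\lambda^{xy}\big)\Bigg|^4\le C\,p^{14/3+\epsilon},$$ where $e_p(z)=\exp(2\pi i z/p)$. -/

import Mathlib

noncomputable section

/-- The additive character `e_p(z) = exp(2πiz/p)` on the integers. -/
def ePhase (p : ℕ) (z : ℤ) : ℂ :=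
  Complex.exp (2 * (Real.pi : ℂ) * Complex.I * (z : ℂ) / (p : ℂ))

/-- The integer `g` is a primitive root modulo `p` (for a prime `p`): its residue class has
multiplicative order `p - 1`. -/
def IsPrimitiveRootMod (p : ℕ) (g : ℤ) : Prop :=
  orderOf (g : ZMod p) = p - 1

/-- The inner sum over `1 ≤ x ≤ p - 1` with `gcd(x, p - 1) = 1`
of `e_p(a g ^ x + b g ^ (x y))`. -/
def innerSum (p : ℕ) (a b g : ℤ) (y : ℕ) : ℂ :=
  ∑ x ∈ (Finset.Icc 1 (p - 1)).filter (fun x => Nat.gcd x (p - 1) = 1),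
    ePhase p (a * g ^ x + b * g ^ (x * y))

/-- The fourth moment `H_{a,b}` over `1 ≤ y ≤ p - 1`. -/
def fourthMoment (p : ℕ) (a b g : ℤ) : ℝ :=
  ∑ y ∈ Finset.Icc 1 (p - 1), ‖innerSum p a b g y‖ ^ 4

end

/-! Möbius inversion over the divisors of `p - 1` turns the coprimality condition into sums over the
subgroups of `d`-th powers. By Hölder, it suffices to bound the fourth moment over `y` for one
subgroup `G`, losing only powers of the divisor count.

For `a ≠ 0`, the sum is unchanged under `(a, b) ↦ (a v, b v ^ y)` with `v ∈ G`. Its fourth power is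
therefore at most the complete fourth moment over all coefficients divided by `|G|`, which by
orthogonality and homogeneity is at most `p ^ 2` times `(solutionSet p y).card`.

Summing over `y`, exchange the roles: fix units with `v₀ + v₁ = v₂ + 1` and count the `y` solving
the power equation. Through discrete logarithms this counts zeros of a four-term sparse polynomial.
Dirichlet approximation lowers its degree (`card_exponents_le`), saving the cube root of the least
order among the `vᵢ`. Averaging over triples gives `p ^ (8/3)` up to divisors, hence `p ^ (14/3)`.
The case `a = 0` uses second moments and gives `p ^ (9/2)`. -/

/-! ### Divisor bounds and sums over element orders. -/

theorem exists_card_divisors_le_mul_rpow (ε : ℝ) (hε : 0 < ε) :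
    ∃ C : ℝ, 0 < C ∧ ∀ n : ℕ, n ≠ 0 → (n.divisors.card : ℝ) ≤ C * (n : ℝ) ^ ε := by
  -- Primes `q ≥ B` satisfy `q ^ ε ≥ 2`, so `v + 1 ≤ 2 ^ v` costs nothing. Each of the fewer than or
  -- equal to `B` smaller primes costs a factor `c`, chosen to suit Bernoulli's inequality.
  set c : ℝ := max 1 (1 / (ε * Real.log 2)) with hc
  set B : ℕ := ⌈(2 : ℝ) ^ (1 / ε)⌉₊ with hB
  have hc1 : 1 ≤ c := le_max_left _ _
  have hl2 : 0 < Real.log 2 := Real.log_pos one_lt_two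
  have hel : 0 < ε * Real.log 2 := by positivity
  have hc2 : 1 ≤ c * (ε * Real.log 2) := by
    have := le_max_right 1 (1 / (ε * Real.log 2))
    rw [← hc, div_le_iff₀ hel] at this
    exact this
  refine ⟨c ^ B, by positivity, fun n hn => ?_⟩
  have key : ∀ q ∈ n.primeFactors, ((n.factorization q + 1 : ℕ) : ℝ) ≤
      (if q < B then c else 1) * ((q : ℝ) ^ n.factorization q) ^ ε := by
    intro q hq
    have hq2 : (2 : ℝ) ≤ q := by exact_mod_cast (Nat.prime_of_mem_primeFactors hq).two_le
    generalize n.factorization q = v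
    have hrw : ((q : ℝ) ^ v) ^ ε = ((q : ℝ) ^ ε) ^ v := by
      rw [← Real.rpow_natCast, ← Real.rpow_natCast, ← Real.rpow_mul (by positivity),
        ← Real.rpow_mul (by positivity), mul_comm]
    rw [hrw]
    push_cast
    split_ifs with h
    · have h1 : (2 : ℝ) ^ ε ≤ (q : ℝ) ^ ε := Real.rpow_le_rpow (by norm_num) hq2 hε.le
      have h2 : ε * Real.log 2 + 1 ≤ (2 : ℝ) ^ ε := by
        rw [Real.rpow_def_of_pos (by norm_num), mul_comm (Real.log 2)]
        exact Real.add_one_le_exp _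
      have h3 : 1 + (v : ℝ) * (ε * Real.log 2) ≤ ((q : ℝ) ^ ε) ^ v := by
        refine (one_add_mul_le_pow (by linarith) v).trans ?_
        exact pow_le_pow_left₀ (by positivity) (by linarith) v
      calc (v : ℝ) + 1 ≤ c * (1 + (v : ℝ) * (ε * Real.log 2)) := by
            nlinarith [mul_le_mul_of_nonneg_left hc2 (Nat.cast_nonneg (α := ℝ) v)]
        _ ≤ _ := by gcongr
    · have h1 : (2 : ℝ) ≤ (q : ℝ) ^ ε := by
        have h2 : (2 : ℝ) ^ (1 / ε) ≤ q :=
          (Nat.le_ceil _).trans (by exact_mod_cast not_lt.mp h)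
        calc (2 : ℝ) = ((2 : ℝ) ^ (1 / ε)) ^ ε := by
              rw [← Real.rpow_mul (by norm_num), one_div_mul_cancel hε.ne', Real.rpow_one]
          _ ≤ _ := Real.rpow_le_rpow (by positivity) h2 hε.le
      rw [one_mul]
      calc (v : ℝ) + 1 ≤ (2 : ℝ) ^ v := by exact_mod_cast Nat.lt_two_pow_self
        _ ≤ _ := pow_le_pow_left₀ (by norm_num) h1 v
  rw [Nat.card_divisors hn, Nat.cast_prod]
  refine (Finset.prod_le_prod (fun _ _ => by positivity) key).trans ?_
  rw [Finset.prod_mul_distrib, Real.finsetProd_rpow _ _ (fun _ _ => by positivity)]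
  have hprod : (∏ q ∈ n.primeFactors, (q : ℝ) ^ n.factorization q) = n := by
    exact_mod_cast Nat.prod_factorization_pow_eq_self hn
  rw [hprod]
  gcongr
  rw [Finset.prod_ite, Finset.prod_const_one, mul_one, Finset.prod_const]
  refine pow_le_pow_right₀ hc1 ?_
  calc _ ≤ (Finset.range B).card := Finset.card_le_card fun q hq => by
        simpa using (Finset.mem_filter.mp hq).2
    _ = B := by simp

/-- A cyclic group has `φ(d) ≤ d` elements of each order `d` dividing its cardinality. -/
theorem sum_orderOf_le_sum_divisors {G : Type*} [Group G] [Fintype G] [IsCyclic G]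
    (h : ℕ → ℝ) (hh : ∀ d, 0 ≤ h d) :
    ∑ w : G, h (orderOf w) ≤ ∑ d ∈ (Fintype.card G).divisors, (d : ℝ) * h d := by
  classical
  rw [← Finset.sum_fiberwise_of_maps_to (s := Finset.univ) (g := fun w : G => orderOf w)
    (t := (Fintype.card G).divisors)
    (fun w _ => Nat.mem_divisors.mpr ⟨orderOf_dvd_card, Fintype.card_ne_zero⟩)]
  refine Finset.sum_le_sum fun d hd => ?_
  rw [Finset.sum_congr rfl (g := fun _ => h d) (fun w hw => by rw [(Finset.mem_filter.mp hw).2]),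
    Finset.sum_const, nsmul_eq_mul, IsCyclic.card_orderOf_eq_totient (Nat.dvd_of_mem_divisors hd)]
  exact mul_le_mul_of_nonneg_right (by exact_mod_cast Nat.totient_le d) (hh d)

/-! ### Moments of exponential sums over subgroups. -/

section

variable {p : ℕ} [Fact p.Prime]

/-- Orthogonality of additive characters in both coefficients: only coinciding pairs survive. -/
theorem sum_norm_sq_charSum {ι : Type*} (I : Finset ι) (x y : ι → ZMod p) :
    ∑ A : ZMod p, ∑ B : ZMod p, ‖∑ i ∈ I, ZMod.stdAddChar (A * x i + B * y i)‖ ^ 2 =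
      (p : ℝ) ^ 2 * ((I ×ˢ I).filter fun q => x q.1 = x q.2 ∧ y q.1 = y q.2).card := by
  apply Complex.ofReal_injective
  push_cast
  have h1 : ∀ A B : ZMod p, ((‖∑ i ∈ I, ZMod.stdAddChar (A * x i + B * y i)‖ : ℝ) : ℂ) ^ 2 =
      ∑ q ∈ I ×ˢ I, (ZMod.stdAddChar (A * (x q.1 - x q.2)) : ℂ) *
        ZMod.stdAddChar (B * (y q.1 - y q.2)) := by
    intro A B
    rw [← Complex.mul_conj', map_sum, Finset.sum_mul_sum, Finset.sum_product]
    refine Finset.sum_congr rfl fun i _ => Finset.sum_congr rfl fun j _ => ?_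
    rw [← AddChar.map_neg_eq_conj, ← AddChar.map_add_eq_mul, ← AddChar.map_add_eq_mul]
    congr 1
    ring
  simp_rw [h1]
  have h2 : ∀ A : ZMod p, ∑ B : ZMod p, ∑ q ∈ I ×ˢ I,
      (ZMod.stdAddChar (A * (x q.1 - x q.2)) : ℂ) * ZMod.stdAddChar (B * (y q.1 - y q.2)) =
      ∑ q ∈ I ×ˢ I, (ZMod.stdAddChar (A * (x q.1 - x q.2)) : ℂ) *
        (if y q.1 - y q.2 = 0 then (p : ℂ) else 0) := by
    intro A
    rw [Finset.sum_comm]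
    refine Finset.sum_congr rfl fun q _ => ?_
    rw [← Finset.mul_sum, AddChar.sum_mulShift _ (ZMod.isPrimitive_stdAddChar p), ZMod.card]
    push_cast
    rfl
  simp_rw [h2]
  rw [Finset.sum_comm]
  simp_rw [← Finset.sum_mul]
  have h3 : ∀ q : ι × ι, ∑ A : ZMod p, (ZMod.stdAddChar (A * (x q.1 - x q.2)) : ℂ) =
      if x q.1 - x q.2 = 0 then (p : ℂ) else 0 := by
    intro q
    rw [AddChar.sum_mulShift _ (ZMod.isPrimitive_stdAddChar p), ZMod.card]
    push_cast
    rfl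
  simp_rw [h3]
  rw [Finset.card_filter, Nat.cast_sum, Finset.mul_sum]
  refine Finset.sum_congr rfl fun q _ => ?_
  by_cases hx : x q.1 = x q.2 <;> by_cases hy : y q.1 = y q.2 <;>
    simp [hx, hy, sub_eq_zero, sq]

open Classical in
/-- The sum of `ψ(a u + b u ^ y)` over the elements `u` of a subgroup of `(ZMod p)ˣ`. -/
noncomputable def subgroupSum (G : Subgroup (ZMod p)ˣ) (a b : ZMod p) (y : ℕ) : ℂ :=
  ∑ u ∈ Finset.univ.filter (fun u => u ∈ G),
    ZMod.stdAddChar (a * ((u : (ZMod p)ˣ) : ZMod p) + b * (u : ZMod p) ^ y)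

theorem subgroupSum_mul_mem (G : Subgroup (ZMod p)ˣ) (a b : ZMod p) (y : ℕ) {v : (ZMod p)ˣ}
    (hv : v ∈ G) : subgroupSum G (a * v) (b * (v : ZMod p) ^ y) y = subgroupSum G a b y := by
  unfold subgroupSum
  refine Finset.sum_bij (fun u _ => v * u) ?_ ?_ ?_ ?_
  · intro u hu
    simpa using G.mul_mem hv (by simpa using hu)
  · intro u _ u' _ h
    exact mul_left_cancel h
  · intro u hu
    exact ⟨v⁻¹ * u, by simpa using G.mul_mem (G.inv_mem hv) (by simpa using hu), by simp⟩
  · intro u _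
    push_cast
    congr 1
    ring

/-- The solutions of `v₀ + v₁ = v₂ + 1`, `v₀ ^ y + v₁ ^ y = v₂ ^ y + 1` in units modulo `p`. -/
noncomputable def solutionSet (p : ℕ) [Fact p.Prime] (y : ℕ) : Finset (Fin 3 → (ZMod p)ˣ) :=
  Finset.univ.filter fun v => (v 0 : ZMod p) + v 1 = v 2 + 1 ∧
    (v 0 : ZMod p) ^ y + (v 1 : ZMod p) ^ y = (v 2 : ZMod p) ^ y + 1

/-- Scaling by `G` produces `|G|` distinct coefficient pairs, since `a ≠ 0`, all with the same sum.
In the complete moment, dividing a solution by its last coordinate leaves a normalized solution and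
`|G|` choices for that coordinate, so `|G|` cancels. -/
theorem norm_subgroupSum_pow_four_le (G : Subgroup (ZMod p)ˣ) {a : ZMod p} (ha : a ≠ 0)
    (b : ZMod p) (y : ℕ) :
    ‖subgroupSum G a b y‖ ^ 4 ≤ (p : ℝ) ^ 2 * (solutionSet p y).card := by
  classical
  set S : Finset (ZMod p)ˣ := Finset.univ.filter (fun u => u ∈ G) with hS
  have hSpos : 0 < (S.card : ℝ) := by
    exact_mod_cast Finset.card_pos.mpr ⟨1, by simp [hS, G.one_mem]⟩
  have hmem : ∀ {u}, u ∈ S → u ∈ G := fun hu => by simpa [hS] using hu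
  let x : (ZMod p)ˣ × (ZMod p)ˣ → ZMod p := fun q => (q.1 : ZMod p) + q.2
  let z : (ZMod p)ˣ × (ZMod p)ˣ → ZMod p := fun q => (q.1 : ZMod p) ^ y + (q.2 : ZMod p) ^ y
  have hsq : ∀ A B, subgroupSum G A B y ^ 2 =
      ∑ q ∈ S ×ˢ S, ZMod.stdAddChar (A * x q + B * z q) := by
    intro A B
    rw [subgroupSum, sq, Finset.sum_mul_sum, Finset.sum_product]
    refine Finset.sum_congr rfl fun i _ => Finset.sum_congr rfl fun j _ => ?_
    rw [← AddChar.map_add_eq_mul]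
    congr 1
    simp only [x, z]
    ring
  have hlow : (S.card : ℝ) * ‖subgroupSum G a b y‖ ^ 4 ≤
      ∑ A : ZMod p, ∑ B : ZMod p, ‖subgroupSum G A B y‖ ^ 4 := by
    rw [← Fintype.sum_prod_type' (fun A B => ‖subgroupSum G A B y‖ ^ 4)]
    calc (S.card : ℝ) * ‖subgroupSum G a b y‖ ^ 4
        = ∑ v ∈ S, ‖subgroupSum G (a * v) (b * (v : ZMod p) ^ y) y‖ ^ 4 := by
          rw [Finset.sum_congr rfl (g := fun _ => ‖subgroupSum G a b y‖ ^ 4)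
            (fun v hv => by rw [subgroupSum_mul_mem G a b y (hmem hv)]),
            Finset.sum_const, nsmul_eq_mul]
      _ = ∑ q ∈ S.image (fun v : (ZMod p)ˣ => (a * (v : ZMod p), b * (v : ZMod p) ^ y)),
            ‖subgroupSum G q.1 q.2 y‖ ^ 4 := by
          rw [Finset.sum_image]
          intro v _ v' _ h
          exact Units.ext (mul_left_cancel₀ ha (Prod.ext_iff.mp h).1)
      _ ≤ _ := Finset.sum_le_sum_of_subset_of_nonneg (Finset.subset_univ _)
          (fun _ _ _ => by positivity)
  have hcount : (((S ×ˢ S) ×ˢ (S ×ˢ S)).filter fun q => x q.1 = x q.2 ∧ z q.1 = z q.2).card ≤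
      (S ×ˢ solutionSet p y).card := by
    refine Finset.card_le_card_of_injOn
      (fun q => (q.2.2, ![q.1.1 / q.2.2, q.1.2 / q.2.2, q.2.1 / q.2.2])) ?_ ?_
    · rintro ⟨⟨u₁, u₂⟩, ⟨u₃, u₄⟩⟩ hq
      simp only [Finset.coe_filter, Finset.mem_product, Set.mem_ofPred_eq, x, z] at hq
      simp only [Finset.coe_product, Set.mem_prod, Finset.mem_coe, solutionSet,
        Finset.mem_filter, Finset.mem_univ, true_and]
      refine ⟨hq.1.2.2, ?_, ?_⟩
      · simp only [Matrix.cons_val, Units.val_div_eq_div_val]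
        have := u₄.ne_zero
        field_simp
        linear_combination hq.2.1
      · simp only [Matrix.cons_val, Units.val_div_eq_div_val, div_pow]
        have := u₄.ne_zero
        field_simp
        linear_combination hq.2.2
    · rintro ⟨⟨u₁, u₂⟩, ⟨u₃, u₄⟩⟩ _ ⟨⟨w₁, w₂⟩, ⟨w₃, w₄⟩⟩ _ h
      simp only [Prod.mk.injEq] at h
      obtain ⟨rfl, h⟩ := h
      have h0 := congrFun h 0
      have h1 := congrFun h 1
      have h2 := congrFun h 2
      simp only [Matrix.cons_val, div_left_inj] at h0 h1 h2
      rw [h0, h1, h2]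
  have hmean : ∑ A : ZMod p, ∑ B : ZMod p, ‖subgroupSum G A B y‖ ^ 4 ≤
      (p : ℝ) ^ 2 * (S.card * (solutionSet p y).card) := by
    have h4 : ∀ A B, ‖subgroupSum G A B y‖ ^ 4 =
        ‖∑ q ∈ S ×ˢ S, ZMod.stdAddChar (A * x q + B * z q)‖ ^ 2 := by
      intro A B
      rw [← hsq, norm_pow, ← pow_mul]
    simp_rw [h4]
    rw [sum_norm_sq_charSum]
    rw [Finset.card_product] at hcount
    gcongr
    exact_mod_cast hcount
  have := hlow.trans hmean
  rw [mul_left_comm] at this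
  exact le_of_mul_le_mul_left this hSpos

/-- Now scaling only moves `b` to `b v ^ y`, and each value is hit at most `K` times, where `K`
counts the solutions of `w ^ y = 1`. The complete second moment contributes another factor `K`. -/
theorem norm_subgroupSum_zero_sq_le (G : Subgroup (ZMod p)ˣ) {b : ZMod p} (hb : b ≠ 0) (y : ℕ) :
    ‖subgroupSum G 0 b y‖ ^ 2 ≤
      (p : ℝ) * ((Finset.univ.filter fun w : (ZMod p)ˣ => w ^ y = 1).card : ℝ) ^ 2 := by
  classical
  set S : Finset (ZMod p)ˣ := Finset.univ.filter (fun u => u ∈ G) with hS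
  set K : Finset (ZMod p)ˣ := Finset.univ.filter fun w : (ZMod p)ˣ => w ^ y = 1 with hK
  have hSpos : 0 < (S.card : ℝ) := by
    exact_mod_cast Finset.card_pos.mpr ⟨1, by simp [hS, G.one_mem]⟩
  have hp : 0 < (p : ℝ) := by exact_mod_cast (Fact.out : p.Prime).pos
  have hmem : ∀ {u}, u ∈ S → u ∈ G := fun hu => by simpa [hS] using hu
  have hpow : ∀ u v : (ZMod p)ˣ, (u : ZMod p) ^ y = (v : ZMod p) ^ y → u / v ∈ K := by
    intro u v h
    simp only [hK, Finset.mem_filter, Finset.mem_univ, true_and, div_pow, div_eq_one]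
    exact Units.ext (by simpa using h)
  have hlow : (S.card : ℝ) * ‖subgroupSum G 0 b y‖ ^ 2 ≤
      K.card * ∑ B : ZMod p, ‖subgroupSum G 0 B y‖ ^ 2 := by
    calc (S.card : ℝ) * ‖subgroupSum G 0 b y‖ ^ 2
        = ∑ v ∈ S, ‖subgroupSum G 0 (b * (v : ZMod p) ^ y) y‖ ^ 2 := by
          rw [Finset.sum_congr rfl (g := fun _ => ‖subgroupSum G 0 b y‖ ^ 2)
            (fun v hv => by
              have := subgroupSum_mul_mem G 0 b y (hmem hv)
              rw [zero_mul] at this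
              rw [this]),
            Finset.sum_const, nsmul_eq_mul]
      _ = ∑ B : ZMod p, ∑ v ∈ S.filter (fun v : (ZMod p)ˣ => b * (v : ZMod p) ^ y = B), ‖subgroupSum G 0 B y‖ ^ 2 := by
          rw [← Finset.sum_fiberwise_of_maps_to (s := S) (t := Finset.univ)
            (g := fun v => b * (v : ZMod p) ^ y) (fun _ _ => Finset.mem_univ _)]
          refine Finset.sum_congr rfl fun B _ => Finset.sum_congr rfl fun v hv => ?_
          rw [(Finset.mem_filter.mp hv).2]
      _ ≤ ∑ B : ZMod p, (K.card : ℝ) * ‖subgroupSum G 0 B y‖ ^ 2 := by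
          refine Finset.sum_le_sum fun B _ => ?_
          rw [Finset.sum_const, nsmul_eq_mul]
          refine mul_le_mul_of_nonneg_right (Nat.cast_le.mpr ?_) (by positivity)
          rcases Finset.eq_empty_or_nonempty
            (S.filter fun v : (ZMod p)ˣ => b * (v : ZMod p) ^ y = B) with h | ⟨v₀, hv₀⟩
          · rw [h]; simp
          · refine Finset.card_le_card_of_injOn (fun v => v / v₀) ?_ ?_
            · intro v hv
              refine hpow v v₀ (mul_left_cancel₀ hb ?_)
              rw [(Finset.mem_filter.mp hv).2, (Finset.mem_filter.mp hv₀).2]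
            · intro v _ v' _ h
              exact div_left_injective h
      _ = _ := by rw [Finset.mul_sum]
  have hcount : ((S ×ˢ S).filter fun q => (q.1 : ZMod p) ^ y = (q.2 : ZMod p) ^ y).card ≤ (S ×ˢ K).card := by
    refine Finset.card_le_card_of_injOn (fun q => (q.2, q.1 / q.2)) ?_ ?_
    · intro q hq
      simp only [Finset.coe_filter, Finset.mem_product, Set.mem_ofPred_eq] at hq
      simpa using ⟨hq.1.2, hpow _ _ hq.2⟩
    · rintro ⟨u, v⟩ _ ⟨u', v'⟩ _ h
      simp only [Prod.mk.injEq] at h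
      obtain ⟨rfl, h⟩ := h
      rw [div_left_injective h]
  -- The first coefficient is idle; its sum contributes the factor `p` cancelled in `hmean'`.
  have hmean : (p : ℝ) * ∑ B : ZMod p, ‖subgroupSum G 0 B y‖ ^ 2 ≤
      (p : ℝ) ^ 2 * (S.card * K.card) := by
    have h := sum_norm_sq_charSum S (fun _ => (0 : ZMod p)) (fun u => (u : ZMod p) ^ y)
    have h' : ∀ A B : ZMod p, ∑ i ∈ S, (ZMod.stdAddChar (A * 0 + B * (i : ZMod p) ^ y) : ℂ) =
        subgroupSum G 0 B y := by
      intro A B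
      simp [subgroupSum, hS]
    simp_rw [h'] at h
    rw [Finset.sum_const, Finset.card_univ, ZMod.card, nsmul_eq_mul] at h
    simp only [true_and] at h
    rw [h]
    rw [Finset.card_product] at hcount
    gcongr
    exact_mod_cast hcount
  have hmean' : ∑ B : ZMod p, ‖subgroupSum G 0 B y‖ ^ 2 ≤ (p : ℝ) * (S.card * K.card) := by
    rw [sq, mul_assoc] at hmean
    exact le_of_mul_le_mul_left hmean hp
  have h := hlow.trans (mul_le_mul_of_nonneg_left hmean' (Nat.cast_nonneg _))
  refine le_of_mul_le_mul_left (h.trans (le_of_eq ?_)) hSpos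
  ring

end

/-! ### Zeros of sparse polynomials. -/

/-- Simultaneous Dirichlet approximation modulo `n`: some multiplier `0 < r < R` brings three
given residues within `n / L` of zero. -/
theorem exists_small_multiple (n R L : ℕ) (hn : 0 < n) (hL : L ^ 3 < R) (hL0 : 0 < L)
    (k : Fin 3 → ℕ) :
    ∃ r : ℕ, 0 < r ∧ r < R ∧ ∃ s : Fin 3 → ℤ,
      ∀ i, (n : ℤ) ∣ (r : ℤ) * k i - s i ∧ (L : ℤ) * |s i| < n := by
  -- Pigeonhole: `R` multipliers fall into `L ^ 3` boxes of side `n / L`.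
  obtain ⟨x, hx, y, hy, hxy, h⟩ := Finset.exists_ne_map_eq_of_card_lt_of_maps_to
    (s := Finset.range R) (t := Fintype.piFinset fun _ : Fin 3 => Finset.range L)
    (f := fun r i => L * ((r * k i) % n) / n) (by simpa using hL) (by
      intro r _
      simp only [Fintype.coe_piFinset, Set.mem_pi, Finset.mem_coe, Finset.mem_range]
      intro i _
      rw [Nat.div_lt_iff_lt_mul hn]
      exact Nat.mul_lt_mul_of_pos_left (Nat.mod_lt _ hn) hL0)
  wlog hlt : x < y generalizing x y
  · exact this y hy x hx hxy.symm h.symm (lt_of_le_of_ne (not_lt.mp hlt) hxy.symm)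
  refine ⟨y - x, by omega, by have := Finset.mem_range.mp hy; omega,
    fun i => ((y * k i) % n : ℕ) - ((x * k i) % n : ℕ), fun i => ⟨?_, ?_⟩⟩
  · rw [Nat.cast_sub hlt.le]
    push_cast
    have e1 := Int.emod_add_mul_ediv ((y : ℤ) * k i) n
    have e2 := Int.emod_add_mul_ediv ((x : ℤ) * k i) n
    exact ⟨(y : ℤ) * k i / n - (x : ℤ) * k i / n, by linear_combination e2 - e1⟩
  · have hi : L * ((x * k i) % n) / n = L * ((y * k i) % n) / n := congrFun h i
    beta_reduce
    generalize (x * k i) % n = u at hi ⊢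
    generalize (y * k i) % n = v at hi ⊢
    have e1 := Nat.div_add_mod (L * u) n
    have e2 := Nat.div_add_mod (L * v) n
    have l1 := Nat.mod_lt (L * u) hn
    have l2 := Nat.mod_lt (L * v) hn
    rw [hi] at e1
    zify at e1 e2 l1 l2
    have p1 : (0 : ℤ) ≤ (L * u : ℤ) % n := Int.emod_nonneg _ (by omega)
    have p2 : (0 : ℤ) ≤ (L * v : ℤ) % n := Int.emod_nonneg _ (by omega)
    rw [← abs_of_nonneg (Int.natCast_nonneg L), ← abs_mul, abs_lt, mul_sub]
    constructor <;> linarith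

section

variable {F : Type*} [Field F] [Fintype F]

open Polynomial in
-- Multiplying by `X ^ M` clears negative exponents. As no `s i` vanishes, the coefficient of `X ^
-- M` is `-1`, so the polynomial is nonzero, of degree at most `2 * M`.
theorem card_laurent_zeros_le [DecidableEq F] (A : Fin 3 → F) (s : Fin 3 → ℤ) (M : ℕ)
    (hs : ∀ i, s i ≠ 0) (hM : ∀ i, |s i| ≤ M) :
    (Finset.univ.filter fun w : Fˣ => ∑ i, A i * ((w ^ s i : Fˣ) : F) = 1).card ≤ 2 * M := by
  set P : F[X] := ∑ i, C (A i) * X ^ (s i + M).toNat - X ^ M with hP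
  have hnn : ∀ i, 0 ≤ s i + M := fun i => by linarith [neg_le_of_abs_le (hM i)]
  have hcoeff : P.coeff M = -1 := by
    have : ∀ i, M ≠ (s i + M).toNat := fun i h => by
      have h1 := Int.toNat_of_nonneg (hnn i)
      have h2 := hs i
      omega
    simp [hP, coeff_X_pow, this]
  have hP0 : P ≠ 0 := fun h => by simp [h] at hcoeff
  have hdeg : P.natDegree ≤ 2 * M := by
    refine (natDegree_sub_le _ _).trans (max_le ?_ (by rw [natDegree_X_pow]; omega))
    refine natDegree_sum_le_of_forall_le _ _ fun i _ => (natDegree_C_mul_X_pow_le _ _).trans ?_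
    have := le_of_abs_le (hM i)
    omega
  calc _ ≤ P.roots.toFinset.card := by
        refine Finset.card_le_card_of_injOn (fun w => (w : F)) ?_
          (fun w _ w' _ h => Units.ext h)
        intro w hw
        have hw : ∑ i, A i * ((w ^ s i : Fˣ) : F) = 1 := by simpa using hw
        refine Finset.mem_coe.mpr (Multiset.mem_toFinset.mpr ((mem_roots hP0).mpr ?_))
        rw [IsRoot.def, hP]
        simp only [eval_sub, eval_finsetSum, eval_mul, eval_C, eval_pow, eval_X]
        have hterm : ∀ i, A i * (w : F) ^ (s i + M).toNat =
            A i * ((w ^ s i : Fˣ) : F) * (w : F) ^ M := fun i => by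
          have : w ^ (s i + M).toNat = w ^ s i * w ^ M := by
            rw [← zpow_natCast, Int.toNat_of_nonneg (hnn i), zpow_add, zpow_natCast]
          rw [mul_assoc, ← Units.val_pow_eq_pow_val, this]
          push_cast
          rfl
        simp_rw [hterm]
        rw [← Finset.sum_mul, hw, one_mul, sub_self]
    _ ≤ P.natDegree := (Multiset.toFinset_card_le _).trans (card_roots' P)
    _ ≤ 2 * M := hdeg

/-- Substitute `z = c * w ^ r`: for each `c`, the exponents in `w` reduce to the small `s i`.
Averaging over `c` avoids any need for `w ↦ w ^ r` to be bijective. -/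
theorem card_sparse_zeros_le [DecidableEq F] (A : Fin 3 → F) (k : Fin 3 → ℕ) (r : ℕ)
    (s : Fin 3 → ℤ) (M : ℕ) (hr : ∀ i, ((Fintype.card Fˣ : ℕ) : ℤ) ∣ (r : ℤ) * k i - s i)
    (hs : ∀ i, s i ≠ 0) (hM : ∀ i, |s i| ≤ M) :
    (Finset.univ.filter fun z : Fˣ => ∑ i, A i * (z : F) ^ k i = 1).card ≤ 2 * M := by
  set f : Fˣ → ℕ := fun z => if ∑ i, A i * (z : F) ^ k i = 1 then 1 else 0 with hf
  have h1 : ∑ w : Fˣ, ∑ c : Fˣ, f (c * w ^ r) = Fintype.card Fˣ * ∑ z, f z := by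
    rw [Finset.sum_congr rfl (g := fun _ => ∑ z, f z)
      (fun w _ => Fintype.sum_equiv (Equiv.mulRight (w ^ r)) (fun c => f (c * w ^ r)) f
        fun _ => rfl)]
    simp
  have h2 : ∑ w : Fˣ, ∑ c : Fˣ, f (c * w ^ r) ≤ Fintype.card Fˣ * (2 * M) := by
    rw [Finset.sum_comm]
    refine (Finset.sum_le_card_nsmul _ _ (2 * M) fun c _ => ?_).trans (by simp)
    refine le_trans (le_of_eq ?_)
      (card_laurent_zeros_le (fun i => A i * (c : F) ^ k i) s M hs hM)
    rw [Finset.card_filter]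
    refine Finset.sum_congr rfl fun w _ => ?_
    have hw : ∀ i, (w ^ r) ^ k i = w ^ s i := fun i => by
      obtain ⟨t, ht⟩ := hr i
      rw [← pow_mul, ← zpow_natCast, Nat.cast_mul, sub_eq_iff_eq_add.mp ht, zpow_add, zpow_mul,
        zpow_natCast, pow_card_eq_one, one_zpow, one_mul]
    simp only [hf, ← hw]
    push_cast
    simp_rw [mul_pow, mul_assoc]
  rw [Finset.card_filter]
  exact Nat.le_of_mul_le_mul_left (h1 ▸ h2) Fintype.card_pos

theorem card_exponents_le [DecidableEq F] (v : Fin 3 → Fˣ) :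
    (((Finset.Icc 1 (Fintype.card Fˣ)).filter fun y =>
      (v 0 : F) ^ y + (v 1 : F) ^ y = (v 2 : F) ^ y + 1).card : ℝ) ≤
      4 * Fintype.card Fˣ * ∑ i, ((orderOf (v i) : ℝ) ^ (1 / 3 : ℝ))⁻¹ := by
  set n := Fintype.card Fˣ with hn
  have hn0 : 0 < n := Fintype.card_pos
  obtain ⟨i₀, hi₀⟩ := Finite.exists_min fun i => orderOf (v i)
  set R := orderOf (v i₀) with hR
  have hR0 : 0 < R := orderOf_pos _
  set ρ : ℝ := (R : ℝ) ^ (1 / 3 : ℝ) with hρ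
  have hρ0 : 0 < ρ := by positivity
  have hρ3 : ρ ^ 3 = R := by
    rw [hρ, ← Real.rpow_natCast, ← Real.rpow_mul (by positivity)]
    norm_num
  suffices hmain : (((Finset.Icc 1 n).filter fun y =>
      (v 0 : F) ^ y + (v 1 : F) ^ y = (v 2 : F) ^ y + 1).card : ℝ) ≤ 4 * n * ρ⁻¹ by
    refine hmain.trans ?_
    gcongr
    exact Finset.single_le_sum (f := fun i => ((orderOf (v i) : ℝ) ^ (1 / 3 : ℝ))⁻¹)
      (fun i _ => by positivity) (Finset.mem_univ i₀)
  by_cases hR1 : R = 1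
  · have h1 : ρ = 1 := by rw [hρ, hR1]; simp
    rw [h1, inv_one, mul_one]
    have : ((Finset.Icc 1 n).filter fun y =>
        (v 0 : F) ^ y + (v 1 : F) ^ y = (v 2 : F) ^ y + 1).card ≤ n :=
      (Finset.card_filter_le _ _).trans (by simp)
    have : (((Finset.Icc 1 n).filter fun y =>
        (v 0 : F) ^ y + (v 1 : F) ^ y = (v 2 : F) ^ y + 1).card : ℝ) ≤ n := by exact_mod_cast this
    linarith [Nat.cast_nonneg (α := ℝ) n]
  have hρ1 : 1 < ρ := by
    rw [hρ]
    refine Real.one_lt_rpow ?_ (by norm_num)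
    exact_mod_cast (by omega : 1 < R)
  -- The largest integer strictly below `ρ`; the floor would break `L ^ 3 < R` when `ρ` is an
  -- integer. Excluding `R = 1` ensures `L > 0`.
  set L := ⌈ρ⌉₊ - 1 with hL
  have hceil : 2 ≤ ⌈ρ⌉₊ := by
    have : 1 < ⌈ρ⌉₊ := by rw [Nat.lt_ceil]; exact_mod_cast hρ1
    omega
  have hL0 : 0 < L := by omega
  have hLlt : (L : ℝ) < ρ := by
    rw [← Nat.lt_ceil]
    omega
  have hLge : ρ ≤ 2 * L := by
    have h1 : ρ ≤ (⌈ρ⌉₊ : ℝ) := Nat.le_ceil _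
    have h2 : (⌈ρ⌉₊ : ℝ) ≤ 2 * L := by exact_mod_cast (by omega : ⌈ρ⌉₊ ≤ 2 * L)
    linarith
  have hL3 : L ^ 3 < R := by
    have : (L : ℝ) ^ 3 < R := by
      rw [← hρ3]
      exact pow_lt_pow_left₀ hLlt (by positivity) (by norm_num)
    exact_mod_cast this
  obtain ⟨γ, hγ⟩ := IsCyclic.exists_generator (α := Fˣ)
  have hγn : orderOf γ = n := by
    rw [orderOf_eq_card_of_forall_mem_zpowers hγ, Nat.card_eq_fintype_card]
  have hk : ∀ i, ∃ k : ℕ, γ ^ k = v i := fun i =>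
    (Submonoid.mem_powers_iff _ _).mp ((mem_powers_iff_mem_zpowers).mpr (hγ (v i)))
  choose k hk using hk
  obtain ⟨r, hr0, hrR, s, hs⟩ := exists_small_multiple n R L hn0 hL3 hL0 k
  -- A zero `s i` would force `v i ^ r = 1` with `0 < r < R`, against the minimality of `R` among
  -- the orders.
  have hs0 : ∀ i, s i ≠ 0 := by
    intro i hi
    have hdvd := (hs i).1
    rw [hi, sub_zero, ← Nat.cast_mul, Int.natCast_dvd_natCast, ← hγn] at hdvd
    have h1 : v i ^ r = 1 := by
      rw [← hk i, ← pow_mul, mul_comm]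
      exact orderOf_dvd_iff_pow_eq_one.mp hdvd
    have := Nat.le_of_dvd hr0 (orderOf_dvd_of_pow_eq_one h1)
    have := hi₀ i
    omega
  have hM : ∀ i, |s i| ≤ ((n / L : ℕ) : ℤ) := by
    intro i
    have h := (hs i).2
    rw [Int.natCast_div]
    rw [Int.le_ediv_iff_mul_le (by exact_mod_cast hL0), mul_comm]
    exact h.le
  have hcard := card_sparse_zeros_le (![1, 1, -1] : Fin 3 → F) k r s (n / L)
    (fun i => (hs i).1) hs0 hM
  have hle : ((Finset.Icc 1 n).filter fun y =>
      (v 0 : F) ^ y + (v 1 : F) ^ y = (v 2 : F) ^ y + 1).card ≤ 2 * (n / L) := by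
    refine le_trans (Finset.card_le_card_of_injOn (fun y => γ ^ y) ?_ ?_) hcard
    · intro y hy
      have hy := (Finset.mem_filter.mp hy).2
      simp only [Finset.coe_filter, Finset.mem_univ, true_and, Set.mem_ofPred_eq,
        Fin.sum_univ_three, Matrix.cons_val]
      have hpow : ∀ i, (((γ ^ y : Fˣ)) : F) ^ k i = (v i : F) ^ y := fun i => by
        rw [← hk i]
        push_cast
        rw [← pow_mul, ← pow_mul, mul_comm]
      rw [hpow, hpow, hpow]
      linear_combination hy
    · intro y hy y' hy' h
      have hy := Finset.mem_Icc.mp (Finset.mem_filter.mp hy).1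
      have hy' := Finset.mem_Icc.mp (Finset.mem_filter.mp hy').1
      have h := pow_eq_pow_iff_modEq.mp h
      rw [hγn] at h
      rcases lt_trichotomy y y' with hlt | heq | hlt
      · have := Nat.le_of_dvd (by omega) ((Nat.modEq_iff_dvd' hlt.le).mp h)
        omega
      · exact heq
      · have := Nat.le_of_dvd (by omega) ((Nat.modEq_iff_dvd' hlt.le).mp h.symm)
        omega
  have hLpos : (0 : ℝ) < L := by exact_mod_cast hL0
  calc _ ≤ ((2 * (n / L) : ℕ) : ℝ) := by exact_mod_cast hle
    _ ≤ 2 * ((n : ℝ) / L) := by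
        push_cast
        gcongr
        exact Nat.cast_div_le
    _ ≤ 4 * n * ρ⁻¹ := by
        rw [← div_eq_mul_inv, ← mul_div_assoc, div_le_div_iff₀ hLpos hρ0]
        nlinarith [Nat.cast_nonneg (α := ℝ) n]

end

/-! ### Averaging the solution counts over `y`. -/

section

variable {p : ℕ} [Fact p.Prime]

theorem sum_card_solutionSet_le :
    ∑ y ∈ Finset.Icc 1 (p - 1), ((solutionSet p y).card : ℝ) ≤
      12 * ((p - 1).divisors.card : ℝ) * (p : ℝ) ^ (8 / 3 : ℝ) := by
  classical
  have hn : Fintype.card (ZMod p)ˣ = p - 1 := ZMod.card_units p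
  have hnp : ((p - 1 : ℕ) : ℝ) ≤ p := by exact_mod_cast Nat.sub_le p 1
  have hp : 0 < (p : ℝ) := by exact_mod_cast (Fact.out : p.Prime).pos
  set n := p - 1 with hndef
  set V : Finset (Fin 3 → (ZMod p)ˣ) :=
    Finset.univ.filter fun v => (v 0 : ZMod p) + v 1 = v 2 + 1 with hV
  set h : (ZMod p)ˣ → ℝ := fun w => ((orderOf w : ℝ) ^ (1 / 3 : ℝ))⁻¹ with hh
  have hh0 : ∀ w, 0 ≤ h w := fun w => by positivity
  have hswap : ∑ y ∈ Finset.Icc 1 n, ((solutionSet p y).card : ℝ) =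
      ∑ v ∈ V, (((Finset.Icc 1 n).filter fun y =>
        (v 0 : ZMod p) ^ y + (v 1 : ZMod p) ^ y = (v 2 : ZMod p) ^ y + 1).card : ℝ) := by
    have h1 : ∀ y, solutionSet p y = V.filter fun v =>
        (v 0 : ZMod p) ^ y + (v 1 : ZMod p) ^ y = (v 2 : ZMod p) ^ y + 1 := fun y => by
      rw [solutionSet, hV, Finset.filter_filter]
    simp_rw [h1, Finset.card_filter]
    push_cast
    exact Finset.sum_comm
  have hone : ∀ i, ∑ v ∈ V, h (v i) ≤ n * ∑ w, h w := by
    intro i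
    rw [← Finset.sum_fiberwise_of_maps_to (s := V) (t := Finset.univ) (g := fun v => v i)
      (fun _ _ => Finset.mem_univ _), Finset.mul_sum]
    refine Finset.sum_le_sum fun w _ => ?_
    rw [Finset.sum_congr rfl (g := fun _ => h w)
      (fun v hv => by rw [(Finset.mem_filter.mp hv).2]), Finset.sum_const, nsmul_eq_mul]
    refine mul_le_mul_of_nonneg_right ?_ (hh0 w)
    rw [← hn, ← Finset.card_univ]
    -- With indices cyclic modulo 3, coordinates `i` and `i + 1` determine the third through the
    -- linear equation.
    refine Nat.cast_le.mpr (Finset.card_le_card_of_injOn (fun v => v (i + 1))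
      (fun _ _ => Finset.mem_coe.mpr (Finset.mem_univ _)) ?_)
    intro v hv v' hv' hvv
    simp only [Finset.coe_filter, hV, Finset.mem_filter, Finset.mem_univ, true_and,
      Set.mem_ofPred_eq] at hv hv'
    obtain ⟨e, hvi⟩ := hv
    obtain ⟨e', hvi'⟩ := hv'
    have hii : v i = v' i := hvi.trans hvi'.symm
    fin_cases i <;> simp at hii hvv <;> funext j <;> fin_cases j <;> simp
    all_goals first
      | assumption
      | skip
    all_goals
      simp only [hii, hvv] at e
      refine Units.ext ?_
    · linear_combination e' - e
    · linear_combination e - e'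
    · linear_combination e - e'
  have hord : ∑ w, h w ≤ (n.divisors.card : ℝ) * (p : ℝ) ^ (2 / 3 : ℝ) := by
    refine (sum_orderOf_le_sum_divisors (G := (ZMod p)ˣ)
      (fun d => ((d : ℝ) ^ (1 / 3 : ℝ))⁻¹) (fun d => by positivity)).trans ?_
    rw [hn]
    refine (Finset.sum_le_card_nsmul _ _ ((p : ℝ) ^ (2 / 3 : ℝ)) fun d hd => ?_).trans
      (by rw [nsmul_eq_mul])
    have hd0 : 0 < (d : ℝ) := by exact_mod_cast Nat.pos_of_mem_divisors hd
    have hdp : (d : ℝ) ≤ p := le_trans (by exact_mod_cast Nat.divisor_le hd) hnp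
    calc (d : ℝ) * ((d : ℝ) ^ (1 / 3 : ℝ))⁻¹ = (d : ℝ) ^ (2 / 3 : ℝ) := by
          rw [← Real.rpow_neg hd0.le]
          nth_rewrite 1 [← Real.rpow_one (d : ℝ)]
          rw [← Real.rpow_add hd0]
          norm_num
      _ ≤ _ := Real.rpow_le_rpow hd0.le hdp (by norm_num)
  rw [hswap]
  calc _ ≤ ∑ v ∈ V, 4 * (n : ℝ) * ∑ i, h (v i) := by
        refine Finset.sum_le_sum fun v _ => ?_
        have := card_exponents_le v
        rwa [hn] at this
    _ = 4 * (n : ℝ) * ∑ i, ∑ v ∈ V, h (v i) := by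
        rw [← Finset.mul_sum, Finset.sum_comm]
    _ ≤ 4 * (n : ℝ) * (3 * (n * ((n.divisors.card : ℝ) * (p : ℝ) ^ (2 / 3 : ℝ)))) := by
        gcongr
        refine (Finset.sum_le_card_nsmul _ _ _ fun i _ => (hone i).trans
          (mul_le_mul_of_nonneg_left hord (Nat.cast_nonneg _))).trans ?_
        simp
    _ ≤ 4 * (p : ℝ) * (3 * (p * ((n.divisors.card : ℝ) * (p : ℝ) ^ (2 / 3 : ℝ)))) := by gcongr
    _ = 12 * (n.divisors.card : ℝ) * ((p : ℝ) ^ (2 : ℝ) * (p : ℝ) ^ (2 / 3 : ℝ)) := by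
        rw [Real.rpow_two]
        ring
    _ = _ := by
        rw [← Real.rpow_add hp]
        norm_num

/-- Each `w` is counted once per multiple of its order up to `p - 1`, so every divisor contributes
at most `p` after grouping by order. -/
theorem sum_card_pow_eq_one_le :
    ∑ y ∈ Finset.Icc 1 (p - 1), ((Finset.univ.filter fun w : (ZMod p)ˣ => w ^ y = 1).card : ℝ) ≤
      ((p - 1).divisors.card : ℝ) * p := by
  classical
  have hn : Fintype.card (ZMod p)ˣ = p - 1 := ZMod.card_units p
  have hnp : ((p - 1 : ℕ) : ℝ) ≤ p := by exact_mod_cast Nat.sub_le p 1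
  have hswap : ∑ y ∈ Finset.Icc 1 (p - 1),
      ((Finset.univ.filter fun w : (ZMod p)ˣ => w ^ y = 1).card : ℝ) =
      ∑ w : (ZMod p)ˣ, (((p - 1) / orderOf w : ℕ) : ℝ) := by
    simp_rw [Finset.card_filter]
    push_cast
    rw [Finset.sum_comm]
    refine Finset.sum_congr rfl fun w _ => ?_
    rw [← Nat.Ioc_filter_dvd_card_eq_div, Finset.card_filter]
    push_cast
    refine Finset.sum_congr rfl fun y _ => ?_
    simp only [orderOf_dvd_iff_pow_eq_one]
  rw [hswap]
  refine (sum_orderOf_le_sum_divisors (G := (ZMod p)ˣ) (fun d => (((p - 1) / d : ℕ) : ℝ))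
    (fun d => by positivity)).trans ?_
  rw [hn]
  refine (Finset.sum_le_card_nsmul _ _ (p : ℝ) fun d _ => ?_).trans (by rw [nsmul_eq_mul])
  refine le_trans ?_ hnp
  exact_mod_cast Nat.mul_div_le (p - 1) d

end

/-! ### Fourth moments and Möbius inversion. -/

section

variable {p : ℕ} [Fact p.Prime]

theorem sum_norm_subgroupSum_pow_four_le (G : Subgroup (ZMod p)ˣ) {a b : ZMod p}
    (hab : ¬(a = 0 ∧ b = 0)) :
    ∑ y ∈ Finset.Icc 1 (p - 1), ‖subgroupSum G a b y‖ ^ 4 ≤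
      12 * ((p - 1).divisors.card : ℝ) * (p : ℝ) ^ (14 / 3 : ℝ) := by
  classical
  have hp : 0 < (p : ℝ) := by exact_mod_cast (Fact.out : p.Prime).pos
  have hp1 : 1 ≤ (p : ℝ) := by exact_mod_cast (Fact.out : p.Prime).one_le
  by_cases ha : a = 0
  · have hb : b ≠ 0 := fun hb => hab ⟨ha, hb⟩
    subst ha
    have hterm : ∀ y, ‖subgroupSum G 0 b y‖ ^ 4 ≤ (p : ℝ) ^ (7 / 2 : ℝ) *
        (Finset.univ.filter fun w : (ZMod p)ˣ => w ^ y = 1).card := by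
      intro y
      have h1 := norm_subgroupSum_zero_sq_le G hb y
      set K : ℝ := ((Finset.univ.filter fun w : (ZMod p)ˣ => w ^ y = 1).card : ℝ) with hK
      have hK0 : 0 ≤ K := Nat.cast_nonneg _
      have h2 : ‖subgroupSum G 0 b y‖ ≤ p := by
        refine (norm_sum_le _ _).trans ?_
        simp only [AddChar.norm_apply, Finset.sum_const, nsmul_eq_mul, mul_one]
        refine Nat.cast_le.mpr ((Finset.card_filter_le _ _).trans ?_)
        rw [Finset.card_univ, ZMod.card_units]
        exact Nat.sub_le p 1
      have h3 : ‖subgroupSum G 0 b y‖ ≤ (p : ℝ) ^ (1 / 2 : ℝ) * K := by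
        refine (sq_le_sq₀ (norm_nonneg _) (by positivity)).mp ?_
        rw [mul_pow, ← Real.rpow_natCast ((p : ℝ) ^ (1 / 2 : ℝ)), ← Real.rpow_mul hp.le]
        norm_num
        exact h1
      -- Bounding three factors trivially by `p` leaves `K` to the first power, whose sum over `y`
      -- is known.
      calc ‖subgroupSum G 0 b y‖ ^ 4 = ‖subgroupSum G 0 b y‖ ^ 3 * ‖subgroupSum G 0 b y‖ := by
            ring
        _ ≤ (p : ℝ) ^ 3 * ((p : ℝ) ^ (1 / 2 : ℝ) * K) := by gcongr
        _ = _ := by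
          rw [← mul_assoc, ← Real.rpow_natCast, ← Real.rpow_add hp]
          norm_num
    calc _ ≤ ∑ y ∈ Finset.Icc 1 (p - 1), (p : ℝ) ^ (7 / 2 : ℝ) *
          ((Finset.univ.filter fun w : (ZMod p)ˣ => w ^ y = 1).card : ℝ) :=
          Finset.sum_le_sum fun y _ => hterm y
      _ ≤ (p : ℝ) ^ (7 / 2 : ℝ) * (((p - 1).divisors.card : ℝ) * p) := by
          rw [← Finset.mul_sum]
          gcongr
          exact sum_card_pow_eq_one_le
      _ = 1 * ((p - 1).divisors.card : ℝ) * (p : ℝ) ^ (9 / 2 : ℝ) := by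
          have : (p : ℝ) ^ (9 / 2 : ℝ) = (p : ℝ) ^ (7 / 2 : ℝ) * p := by
            nth_rewrite 3 [← Real.rpow_one (p : ℝ)]
            rw [← Real.rpow_add hp]
            norm_num
          rw [this]
          ring
      _ ≤ _ := by
          gcongr ?_ * _ * _ ^ ?_
          · norm_num
          · norm_num
  · calc _ ≤ ∑ y ∈ Finset.Icc 1 (p - 1), (p : ℝ) ^ 2 * ((solutionSet p y).card : ℝ) :=
          Finset.sum_le_sum fun y _ => norm_subgroupSum_pow_four_le G ha b y
      _ ≤ (p : ℝ) ^ 2 *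
          (12 * ((p - 1).divisors.card : ℝ) * (p : ℝ) ^ (8 / 3 : ℝ)) := by
          rw [← Finset.mul_sum]
          gcongr
          exact sum_card_solutionSet_le
      _ = 12 * ((p - 1).divisors.card : ℝ) * ((p : ℝ) ^ (2 : ℝ) * (p : ℝ) ^ (8 / 3 : ℝ)) := by
          rw [Real.rpow_two]
          ring
      _ = _ := by
          rw [← Real.rpow_add hp]
          norm_num

theorem subgroupSum_range_pow {γ : (ZMod p)ˣ} (hγ : orderOf γ = p - 1) {d : ℕ}
    (hd : d ∣ p - 1) (a b : ZMod p) (y : ℕ) :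
    subgroupSum (powMonoidHom d).range a b y =
      ∑ x ∈ (Finset.Icc 1 (p - 1)).filter (fun x => d ∣ x),
        ZMod.stdAddChar (a * (γ : ZMod p) ^ x + b * (γ : ZMod p) ^ (x * y)) := by
  symm
  have hn : 0 < p - 1 := hγ ▸ orderOf_pos γ
  have hgen : ∀ u : (ZMod p)ˣ, u ∈ Subgroup.zpowers γ := fun u => by
    rw [Subgroup.eq_top_of_card_eq (Subgroup.zpowers γ)
      (by rw [Nat.card_zpowers, hγ, Nat.card_eq_fintype_card, ZMod.card_units])]
    exact Subgroup.mem_top u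
  unfold subgroupSum
  refine Finset.sum_bij (fun x _ => γ ^ x) ?_ ?_ ?_ ?_
  · intro x hx
    obtain ⟨k, rfl⟩ := (Finset.mem_filter.mp hx).2
    simp only [Finset.mem_filter, Finset.mem_univ, true_and]
    exact ⟨γ ^ k, by simp [← pow_mul, mul_comm]⟩
  · intro x hx x' hx' h
    have hx := Finset.mem_Icc.mp (Finset.mem_filter.mp hx).1
    have hx' := Finset.mem_Icc.mp (Finset.mem_filter.mp hx').1
    have h := pow_eq_pow_iff_modEq.mp h
    rw [hγ] at h
    rcases lt_trichotomy x x' with hlt | heq | hlt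
    · have := Nat.le_of_dvd (by omega) ((Nat.modEq_iff_dvd' hlt.le).mp h)
      omega
    · exact heq
    · have := Nat.le_of_dvd (by omega) ((Nat.modEq_iff_dvd' hlt.le).mp h.symm)
      omega
  · intro u hu
    simp only [Finset.mem_filter, Finset.mem_univ, true_and] at hu
    obtain ⟨v, rfl⟩ := hu
    obtain ⟨k, rfl⟩ := (Submonoid.mem_powers_iff _ _).mp (mem_powers_iff_mem_zpowers.mpr (hgen v))
    -- Exponents run over `1, …, p - 1`, so residue `0` is represented by `p - 1`.
    refine ⟨(d * k) % (p - 1) + (if (d * k) % (p - 1) = 0 then p - 1 else 0), ?_, ?_⟩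
    · have hlt := Nat.mod_lt (d * k) hn
      have hdvd : d ∣ (d * k) % (p - 1) := (Nat.dvd_mod_iff hd).mpr (dvd_mul_right d k)
      simp only [Finset.mem_filter, Finset.mem_Icc]
      split_ifs with h
      · exact ⟨by omega, dvd_add hdvd hd⟩
      · exact ⟨by omega, by simpa using hdvd⟩
    · have hpow : γ ^ (if (d * k) % (p - 1) = 0 then p - 1 else 0) = 1 := by
        split_ifs
        · rw [← hγ, pow_orderOf_eq_one]
        · simp
      rw [pow_add, hpow, mul_one, ← hγ, pow_mod_orderOf]
      simp [← pow_mul, mul_comm]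
  · intro x _
    push_cast
    rw [pow_mul]

theorem ePhase_eq_stdAddChar (z : ℤ) : ePhase p z = ZMod.stdAddChar (z : ZMod p) :=
  (ZMod.stdAddChar_coe z).symm

theorem innerSum_eq_sum_moebius {γ : (ZMod p)ˣ} (hγ : orderOf γ = p - 1) {g : ℤ}
    (hg : (γ : ZMod p) = g) (a b : ℤ) (y : ℕ) :
    innerSum p a b g y = ∑ d ∈ (p - 1).divisors,
      (ArithmeticFunction.moebius d : ℂ) * subgroupSum (powMonoidHom d).range (a : ZMod p) b y := by
  have hn : 0 < p - 1 := hγ ▸ orderOf_pos γ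
  have hind : ∀ x, (if Nat.gcd x (p - 1) = 1 then (1 : ℂ) else 0) =
      ∑ d ∈ (p - 1).divisors, if d ∣ x then (ArithmeticFunction.moebius d : ℂ) else 0 := by
    intro x
    have h1 := ArithmeticFunction.coe_mul_zeta_apply (f := ArithmeticFunction.moebius)
      (x := Nat.gcd x (p - 1))
    rw [ArithmeticFunction.moebius_mul_coe_zeta, ArithmeticFunction.one_apply] at h1
    have h2 : (Nat.gcd x (p - 1)).divisors = (p - 1).divisors.filter fun d => d ∣ x := by
      ext d
      simp only [Nat.mem_divisors, Finset.mem_filter, Nat.dvd_gcd_iff]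
      have := Nat.gcd_pos_of_pos_right x hn
      constructor
      · rintro ⟨⟨h, h'⟩, -⟩
        exact ⟨⟨h', hn.ne'⟩, h⟩
      · rintro ⟨⟨h, -⟩, h'⟩
        exact ⟨⟨h', h⟩, this.ne'⟩
    rw [← Finset.sum_filter, ← h2]
    exact_mod_cast congrArg (Int.cast : ℤ → ℂ) h1
  have hphase : ∀ x, ePhase p (a * g ^ x + b * g ^ (x * y)) =
      ZMod.stdAddChar ((a : ZMod p) * (γ : ZMod p) ^ x + (b : ZMod p) * (γ : ZMod p) ^ (x * y)) := by
    intro x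
    rw [ePhase_eq_stdAddChar, hg]
    push_cast
    rfl
  unfold innerSum
  simp_rw [hphase]
  rw [Finset.sum_filter]
  calc _ = ∑ x ∈ Finset.Icc 1 (p - 1), ∑ d ∈ (p - 1).divisors,
        (ArithmeticFunction.moebius d : ℂ) * if d ∣ x then
          ZMod.stdAddChar ((a : ZMod p) * (γ : ZMod p) ^ x + (b : ZMod p) * (γ : ZMod p) ^ (x * y)) else 0 := by
        refine Finset.sum_congr rfl fun x _ => ?_
        rw [← boole_mul, hind, Finset.sum_mul]
        refine Finset.sum_congr rfl fun d _ => ?_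
        split_ifs <;> simp
    _ = _ := by
        rw [Finset.sum_comm]
        refine Finset.sum_congr rfl fun d hd => ?_
        rw [← Finset.mul_sum, ← Finset.sum_filter,
          subgroupSum_range_pow hγ (Nat.dvd_of_mem_divisors hd)]

theorem fourthMoment_le {a b g : ℤ} (hab : Nat.gcd (Int.gcd a b) p = 1)
    (hg : IsPrimitiveRootMod p g) :
    fourthMoment p a b g ≤ 12 * ((p - 1).divisors.card : ℝ) ^ 5 * (p : ℝ) ^ (14 / 3 : ℝ) := by
  have hp : p.Prime := Fact.out
  have hn : 0 < p - 1 := by have := hp.two_le; omega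
  have hg : orderOf (g : ZMod p) = p - 1 := hg
  have hg0 : (g : ZMod p) ≠ 0 := by
    intro h
    have h1 := pow_orderOf_eq_one (g : ZMod p)
    rw [hg, h, zero_pow hn.ne'] at h1
    exact zero_ne_one h1
  have hγ : orderOf (Units.mk0 (g : ZMod p) hg0) = p - 1 := by
    rw [← orderOf_units, Units.val_mk0, hg]
  have hab0 : ¬((a : ZMod p) = 0 ∧ (b : ZMod p) = 0) := by
    rintro ⟨h1, h2⟩
    rw [ZMod.intCast_zmod_eq_zero_iff_dvd] at h1 h2
    have h3 : p ∣ Int.gcd a b := Int.natCast_dvd_natCast.mp (Int.dvd_coe_gcd h1 h2)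
    exact hp.one_lt.ne' (Nat.dvd_one.mp (hab ▸ Nat.dvd_gcd h3 dvd_rfl))
  set D := (p - 1).divisors with hD
  set T : ℕ → ℕ → ℝ := fun d y =>
    ‖subgroupSum (powMonoidHom d).range (a : ZMod p) (b : ZMod p) y‖ with hT
  have hT0 : ∀ d y, 0 ≤ T d y := fun d y => norm_nonneg _
  have hinner : ∀ y, ‖innerSum p a b g y‖ ^ 4 ≤ (D.card : ℝ) ^ 3 * ∑ d ∈ D, T d y ^ 4 := by
    intro y
    have h1 : ‖innerSum p a b g y‖ ≤ ∑ d ∈ D, T d y := by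
      rw [innerSum_eq_sum_moebius hγ (Units.val_mk0 hg0)]
      refine (norm_sum_le _ _).trans (Finset.sum_le_sum fun d _ => ?_)
      rw [norm_mul]
      refine mul_le_of_le_one_left (norm_nonneg _) ?_
      rw [Complex.norm_intCast]
      exact_mod_cast ArithmeticFunction.abs_moebius_le_one
    refine (pow_le_pow_left₀ (norm_nonneg _) h1 4).trans ?_
    exact pow_sum_le_card_mul_sum_pow (fun d _ => hT0 d y) 3
  calc fourthMoment p a b g
      ≤ ∑ y ∈ Finset.Icc 1 (p - 1), (D.card : ℝ) ^ 3 * ∑ d ∈ D, T d y ^ 4 :=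
        Finset.sum_le_sum fun y _ => hinner y
    _ = (D.card : ℝ) ^ 3 * ∑ d ∈ D, ∑ y ∈ Finset.Icc 1 (p - 1), T d y ^ 4 := by
        rw [← Finset.mul_sum, Finset.sum_comm]
    _ ≤ (D.card : ℝ) ^ 3 * (D.card * (12 * (D.card : ℝ) * (p : ℝ) ^ (14 / 3 : ℝ))) := by
        gcongr
        refine (Finset.sum_le_card_nsmul _ _ _ fun d _ =>
          sum_norm_subgroupSum_pow_four_le _ hab0).trans ?_
        rw [nsmul_eq_mul]
    _ = _ := by ring

end

theorem lemma1 (ε : ℝ) (hε : 0 < ε) :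
    ∃ C : ℝ, 0 < C ∧ ∀ (p : ℕ), p.Prime → ∀ (a b g : ℤ),
      Nat.gcd (Int.gcd a b) p = 1 → IsPrimitiveRootMod p g →
        fourthMoment p a b g ≤ C * (p : ℝ) ^ ((14 : ℝ) / 3 + ε) := by
  -- The divisor count enters to the fifth power: three from Hölder, one from summing over `d`, one
  -- from each subgroup's moment bound.
  obtain ⟨C, hC, hdiv⟩ := exists_card_divisors_le_mul_rpow (ε / 5) (by positivity)
  refine ⟨12 * C ^ 5, by positivity, fun p hp a b g hab hg => ?_⟩
  have : Fact p.Prime := ⟨hp⟩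
  have hp0 : 0 < (p : ℝ) := by exact_mod_cast hp.pos
  have hn : p - 1 ≠ 0 := by have := hp.two_le; omega
  have hτ : ((p - 1).divisors.card : ℝ) ≤ C * (p : ℝ) ^ (ε / 5) := by
    refine (hdiv _ hn).trans ?_
    gcongr
    exact Nat.sub_le p 1
  calc fourthMoment p a b g
      ≤ 12 * ((p - 1).divisors.card : ℝ) ^ 5 * (p : ℝ) ^ (14 / 3 : ℝ) := fourthMoment_le hab hg
    _ ≤ 12 * (C * (p : ℝ) ^ (ε / 5)) ^ 5 * (p : ℝ) ^ (14 / 3 : ℝ) := by gcongr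
    _ = 12 * C ^ 5 * ((p : ℝ) ^ (14 / 3 : ℝ) * (p : ℝ) ^ ε) := by
        rw [mul_pow, ← Real.rpow_natCast ((p : ℝ) ^ (ε / 5)), ← Real.rpow_mul hp0.le]
        norm_num
        ring
    _ = _ := by rw [← Real.rpow_add hp0]
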